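/- **Setting.** Let $n\in\mathbb N$ and let $\mathcal G_0$ be the ring (without unit) of germs at $0$ of arbitrary, not necessarily continuous, functions $(\mathbb R^n,0)\to(\mathbb R,0)$. Let $\mathcal G_0^0\subset\mathcal G_0$ be the set of germs that have a representative which is continuous on some neighbourhood of $0$. Let ${}^*$ denote the nonstandard extension given by the ultrapower with respect to an arbitrary ultrafilter on an arbitrary set, and fix $\delta\in{}^*\mathbb R$ with $0<\delta\sim 0$, that is, $0<\delta<r$ for every standard real $r>0$. Put $B_\delta=\{\xi\in{}^*\mathbb R^n:|\xi|\le\delta\}$ and, for $[f]\in\mathcal G_0$, $$\|{}^*f\|_\delta={}^*\!\sup\{|{}^*f(\xi)|:\xi\in B_\delta\},$$ with the value $\infty$ if ${}^*f$ is unbounded on $B_\delta$ (this depends only on the germ $[f]$). Let $$\mathcal N_\delta=\{\|{}^*g\|_\delta:[g]\in\mathcal G_0,\ 0<\|{}^*g\|_\delta<\infty\}\subset{}^*\mathbb R$$ and, for $\mathfrak r\in\mathcal N_\delta$, let $U_{\mathfrak r}=\{[f]\in\mathcal G_0:\|{}^*f\|_\delta<\mathfrak r\}$. Say that a net $([f_d])_{d\in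 D}$ in $\mathcal G_0$, indexed by a nonempty directed set $D$, is $\tau_0$-convergent to $[g]\in\mathcal G_0$ if for every $\mathfrak r\in\mathcal N_\delta$ there is $d_0\in D$ such that $[f_d]-[g]\in U_{\mathfrak r}$ for all $d\ge d_0$. Let $\tau$ be the topology on $\mathcal G_0$ generated by all the translates $[f]+U_{\mathfrak r}$, $[f]\in\mathcal G_0$, $\mathfrak r\in\mathcal N_\delta$. **Theorem.** 1. Let $D$ be a nonempty directed set and let $d\mapsto[f_d]$ be a $D$-net in $\mathcal G_0^0$ that is $\tau_0$-convergent to $[g]\in\mathcal G_0$. Then $[g]\in\mathcal G_0^0$. 2. $\mathcal G_0^0$ is a subring of $\mathcal G_0$ that is closed in the topology $\tau$. -/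

import Mathlib

open Filter Topology

universe u v

namespace GermTopology

/-- `ℝⁿ` with its Euclidean norm. -/
abbrev E (n : ℕ) : Type := EuclideanSpace ℝ (Fin n)

/-- The ring `𝒢₀` of germs at `0` of (arbitrary) functions `(ℝⁿ, 0) → (ℝ, 0)`, as a
subring (without unit) of the ring of all germs at `0` of functions `ℝⁿ → ℝ`. -/
def germRing (n : ℕ) : NonUnitalSubring ((𝓝 (0 : E n)).Germ ℝ) where
  carrier := {f | f.value = 0}
  zero_mem' := rfl
  add_mem' := by
    intro f g hf hg
    induction f using Germ.inductionOn with | _ f => ?_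
    induction g using Germ.inductionOn with | _ g => ?_
    change f 0 = 0 at hf
    change g 0 = 0 at hg
    change f 0 + g 0 = 0
    rw [hf, hg, add_zero]
  mul_mem' := by
    intro f g hf hg
    induction f using Germ.inductionOn with | _ f => ?_
    induction g using Germ.inductionOn with | _ g => ?_
    change f 0 = 0 at hf
    change f 0 * g 0 = 0
    rw [hf, zero_mul]
  neg_mem' := by
    intro f hf
    induction f using Germ.inductionOn with | _ f => ?_
    change f 0 = 0 at hf
    change - f 0 = 0
    rw [hf, neg_zero]

/-- A germ is continuous if it has a representative continuous on a neighbourhood of `0`. -/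
def IsContinuousGerm {n : ℕ} (f : germRing n) : Prop :=
  ∃ F : E n → ℝ, (F : (𝓝 (0 : E n)).Germ ℝ) = f.1 ∧ ∃ U ∈ 𝓝 (0 : E n), ContinuousOn F U

section Nonstandard

variable {ι : Type u} (φ : Ultrafilter ι)

/-- The nonstandard extension (ultrapower with respect to `φ`) of a set `X`. -/
abbrev Star (X : Type) : Type u := (φ : Filter ι).Germ X

variable {φ}

/-- `0 < δ` and `δ` is smaller than every standard positive real. -/
def IsPosInfinitesimal (δ : Star φ ℝ) : Prop :=
  0 < δ ∧ ∀ r : ℝ, 0 < r → δ < (r : Star φ ℝ)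

/-- The internal ball `B_δ = {ξ ∈ *ℝⁿ : |ξ| ≤ δ}`. -/
def starBall (n : ℕ) (δ : Star φ ℝ) : Set (Star φ (E n)) :=
  {ξ | Germ.map (fun x : E n => ‖x‖) ξ ≤ δ}

/-- `s = *sup {|*F(ξ)| : ξ ∈ B_δ}`. The set is internal, so that its internal supremum is its
least upper bound in `*ℝ`. No `s` has this property if `*F` is unbounded on `B_δ`. -/
def HasStarNorm {n : ℕ} (δ : Star φ ℝ) (F : E n → ℝ) (s : Star φ ℝ) : Prop :=
  IsLUB ((fun ξ : Star φ (E n) => Germ.map (fun x => |F x|) ξ) '' starBall n δ) s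

/-- For a positive infinitesimal `δ` the number `‖*f‖_δ` depends only on the germ. -/
theorem HasStarNorm.congr {n : ℕ} {δ : Star φ ℝ} (hδ : IsPosInfinitesimal δ) {F G : E n → ℝ}
    (h : F =ᶠ[𝓝 0] G) {s : Star φ ℝ} (hF : HasStarNorm δ F s) : HasStarNorm δ G s := by
  have key : ∀ ξ ∈ starBall n δ,
      Germ.map (fun x => |F x|) ξ = Germ.map (fun x => |G x|) ξ := by
    intro ξ hξ
    obtain ⟨r, hr, hb⟩ := Metric.eventually_nhds_iff.1 h
    have h1 : Germ.map (fun x : E n => ‖x‖) ξ < (r : Star φ ℝ) := lt_of_le_of_lt hξ (hδ.2 r hr)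
    induction ξ using Germ.inductionOn with | _ x => ?_
    have h2 : ∀ᶠ i in (φ : Filter ι), ‖x i‖ < r := Germ.coe_lt.1 h1
    refine Germ.coe_eq.2 ?_
    filter_upwards [h2] with i hi
    have := hb (y := x i) (by simpa using hi)
    simp [this]
  unfold HasStarNorm at *
  rwa [← Set.image_congr key]

/-- The set of moduli `𝒩_δ`: the positive numbers `‖*g‖_δ` for `[g] ∈ 𝒢₀`. -/
def moduli (n : ℕ) (δ : Star φ ℝ) : Set (Star φ ℝ) :=
  {r | 0 < r ∧ ∃ G : E n → ℝ, G 0 = 0 ∧ HasStarNorm δ G r}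

/-- The set `U_r = {[f] ∈ 𝒢₀ : ‖*f‖_δ < r}`. -/
def nbhd (n : ℕ) (δ r : Star φ ℝ) : Set (germRing n) :=
  {f | ∃ F : E n → ℝ, (F : (𝓝 (0 : E n)).Germ ℝ) = f.1 ∧ ∃ s, HasStarNorm δ F s ∧ s < r}

/-- Convergence of nets: `‖*f_d - *g‖_δ` is eventually smaller than every element of `𝒩_δ`. -/
def NetConverges {n : ℕ} (δ : Star φ ℝ) {D : Type v} [Preorder D] (f : D → germRing n)
    (g : germRing n) : Prop :=
  ∀ r ∈ moduli n δ, ∃ d₀ : D, ∀ d, d₀ ≤ d → f d - g ∈ nbhd n δ r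

/-- The topology on `𝒢₀` generated by all translates of the sets `U_r`, `r ∈ 𝒩_δ`. -/
@[reducible] def tau (n : ℕ) (δ : Star φ ℝ) : TopologicalSpace (germRing n) :=
  TopologicalSpace.generateFrom
    {V | ∃ f : germRing n, ∃ r ∈ moduli n δ, V = (fun u => u + f) '' nbhd n δ r}

end Nonstandard

end GermTopology

/-! A germ `g` outside `𝒢₀⁰` has discontinuities in every ball around `0`, so its largest jump
`maxJump g t` is positive for every `t > 0`. This function of `t` is monotone and vanishes at `0`,
hence `maxJump g ‖x‖ / 4` is itself a germ in `𝒢₀`, whose star norm is a quarter of the jump of `g`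
at scale `δ`. Thus `g` supplies its own modulus: a continuous germ closer to `g` than that would
force the jump to be at most half of itself. Both claims follow from this separation,
`exists_modulus_separating`. -/

namespace GermTopology

section Oscillation

variable {X : Type*} [SeminormedAddCommGroup X]

/-- The numbers `e ∈ [0, 1]` such that `g` jumps by at least `e` at some point of the open ball of
radius `t`, together with `0`. -/
def jumps (g : X → ℝ) (t : ℝ) : Set ℝ :=
  {e | e = 0 ∨ (0 ≤ e ∧ e ≤ 1 ∧ ∃ x, ‖x‖ < t ∧ ∃ᶠ y in 𝓝 x, e ≤ |g y - g x|)}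

/-- The supremum of the jumps of `g` in the open ball of radius `t`, cut off at `1`. -/
noncomputable def maxJump (g : X → ℝ) (t : ℝ) : ℝ := sSup (jumps g t)

theorem zero_mem_jumps (g : X → ℝ) (t : ℝ) : 0 ∈ jumps g t := Or.inl rfl

/-- The cut-off at `1` serves this: for an unbounded set `sSup` would return `0` and lose the jumps.
-/
theorem bddAbove_jumps (g : X → ℝ) (t : ℝ) : BddAbove (jumps g t) := by
  refine ⟨1, ?_⟩
  rintro e (rfl | ⟨-, h, -⟩)
  · exact zero_le_one
  · exact h

theorem maxJump_nonneg (g : X → ℝ) (t : ℝ) : 0 ≤ maxJump g t :=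
  le_csSup (bddAbove_jumps g t) (zero_mem_jumps g t)

theorem maxJump_mono (g : X → ℝ) : Monotone (maxJump g) := by
  intro s t hst
  refine csSup_le_csSup (bddAbove_jumps g t) ⟨0, zero_mem_jumps g s⟩ ?_
  rintro e (rfl | ⟨h0, h1, x, hx, hy⟩)
  · exact zero_mem_jumps g t
  · exact Or.inr ⟨h0, h1, x, hx.trans_le hst, hy⟩

/-- The open ball of radius `0` is empty. This puts the radial function built from `maxJump g` into
`𝒢₀`. -/
theorem maxJump_zero (g : X → ℝ) : maxJump g 0 = 0 := by
  refine le_antisymm (csSup_le ⟨0, zero_mem_jumps g 0⟩ ?_) (maxJump_nonneg g 0)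
  rintro e (rfl | ⟨-, -, x, hx, -⟩)
  · exact le_rfl
  · exact absurd hx (norm_nonneg x).not_gt

theorem maxJump_pos {g : X → ℝ} {t : ℝ} (h : ¬ ContinuousOn g (Metric.ball 0 t)) :
    0 < maxJump g t := by
  have h' : ∃ x, ‖x‖ < t ∧ ¬ ContinuousAt g x := by
    by_contra! hc
    exact h fun x hx => (hc x (by simpa using hx)).continuousWithinAt
  obtain ⟨x, hx, hd⟩ := h'
  have h2 : ∃ e > 0, ∃ᶠ y in 𝓝 x, e ≤ |g y - g x| := by
    by_contra! hc
    refine hd (Metric.tendsto_nhds.2 fun e he => ?_)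
    filter_upwards [hc e he] with y hy
    rwa [Real.dist_eq]
  obtain ⟨e, he, hy⟩ := h2
  have hmem : min e 1 ∈ jumps g t :=
    Or.inr ⟨by positivity, min_le_right _ _, x, hx, hy.mono fun y h => (min_le_left _ _).trans h⟩
  exact (lt_min he one_pos).trans_le (le_csSup (bddAbove_jumps g t) hmem)

/-- A function within `c` of a continuous one on a ball has jumps at most `2 * c` there. -/
theorem maxJump_le_of_near {f g : X → ℝ} {t c : ℝ} (hc : 0 ≤ c)
    (hf : ContinuousOn f (Metric.ball 0 t))
    (h : ∀ x ∈ Metric.ball (0 : X) t, |f x - g x| ≤ c) : maxJump g t ≤ 2 * c := by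
  refine csSup_le ⟨0, zero_mem_jumps g t⟩ ?_
  rintro e (rfl | ⟨-, -, x, hx, hy⟩)
  · positivity
  · have hxb : x ∈ Metric.ball (0 : X) t := by simpa using hx
    have hnb := Metric.isOpen_ball.mem_nhds hxb
    -- Passing from `g y` to `g x` through `f y` and `f x` costs `c + ε + c`.
    refine le_of_forall_pos_le_add fun ε hε => ?_
    have hcont := Metric.tendsto_nhds.1 (hf.continuousAt hnb) ε hε
    obtain ⟨y, hy, hyb, hyf⟩ := (hy.and_eventually ((eventually_mem_set.2 hnb).and hcont)).exists
    rw [Real.dist_eq] at hyf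
    have h1 := abs_le.1 (h x hxb)
    have h2 := abs_le.1 (h y hyb)
    have h3 := abs_lt.1 hyf
    refine hy.trans (abs_le.2 ⟨?_, ?_⟩) <;> linarith [h1.1, h1.2, h2.1, h2.2, h3.1, h3.2]

end Oscillation

section Nonstandard

variable {ι : Type u} {φ : Ultrafilter ι} {n : ℕ}

/-- The star norm of a radial function with monotone nonnegative profile is the value of the
profile at `δ`. -/
theorem hasStarNorm_radial [Nontrivial (E n)] {d : ι → ℝ} (hd : ∀ᶠ i in (φ : Filter ι), 0 < d i)
    {m : ℝ → ℝ} (hm : Monotone m) (h0 : ∀ t, 0 ≤ m t) :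
    HasStarNorm (d : Star φ ℝ) (fun x : E n => m ‖x‖) ((fun i => m (d i) : ι → ℝ) : Star φ ℝ) := by
  refine IsGreatest.isLUB ⟨?_, ?_⟩
  -- The supremum is attained on the sphere of radius `δ`. The absolute value covers the negligible
  -- indices where `d i` is not positive.
  · choose x hx using fun i => exists_norm_eq (E n) (abs_nonneg (d i))
    have hxd : ∀ᶠ i in (φ : Filter ι), ‖x i‖ = d i :=
      hd.mono fun i hi => (hx i).trans (abs_of_pos hi)
    refine ⟨(x : Star φ (E n)), Germ.coe_le.2 (hxd.mono fun i hi => hi.le),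
      Germ.coe_eq.2 (hxd.mono fun i hi => ?_)⟩
    change |m ‖x i‖| = m (d i)
    rw [hi, abs_of_nonneg (h0 _)]
  · rintro _ ⟨ξ, hξ, rfl⟩
    induction ξ using Germ.inductionOn with | _ x => ?_
    have hξ' : ∀ᶠ i in (φ : Filter ι), ‖x i‖ ≤ d i := Germ.coe_le.1 hξ
    refine Germ.coe_le.2 (hξ'.mono fun i hi => ?_)
    change |m ‖x i‖| ≤ m (d i)
    rw [abs_of_nonneg (h0 _)]
    exact hm hi

/-- A star norm smaller than `r` bounds the function on almost all the balls of radius `d i`. -/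
theorem HasStarNorm.eventually_lt {d r : ι → ℝ} {F : E n → ℝ} {s : Star φ ℝ}
    (hF : HasStarNorm (d : Star φ ℝ) F s) (hs : s < (r : Star φ ℝ)) :
    ∀ᶠ i in (φ : Filter ι), ∀ x : E n, ‖x‖ ≤ d i → |F x| < r i := by
  by_contra hc
  rw [← Ultrafilter.eventually_not] at hc
  push Not at hc
  -- Counterexamples exist for almost all `i`; with `0` elsewhere they form one point of `B_δ` that
  -- violates the bound.
  have hex : ∀ i, ∃ x : E n, (∃ x : E n, ‖x‖ ≤ d i ∧ r i ≤ |F x|) → ‖x‖ ≤ d i ∧ r i ≤ |F x| := by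
    intro i
    by_cases h : ∃ x : E n, ‖x‖ ≤ d i ∧ r i ≤ |F x|
    · exact ⟨h.choose, fun _ => h.choose_spec⟩
    · exact ⟨0, fun h' => absurd h' h⟩
  choose x hx using hex
  have hball : (x : Star φ (E n)) ∈ starBall n (d : Star φ ℝ) :=
    Germ.coe_le.2 (hc.mono fun i hi => (hx i hi).1)
  have hle : (r : Star φ ℝ) ≤ Germ.map (fun x => |F x|) (x : Star φ (E n)) :=
    Germ.coe_le.2 (hc.mono fun i hi => (hx i hi).2)
  exact absurd (hle.trans (hF.1 ⟨_, hball, rfl⟩)) (not_le.2 hs)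

theorem zero_mem_nbhd {δ r : Star φ ℝ} (hδ : 0 < δ) (hr : 0 < r) :
    (0 : germRing n) ∈ nbhd n δ r := by
  refine ⟨0, rfl, 0, IsGreatest.isLUB ⟨?_, ?_⟩, hr⟩
  · refine ⟨((fun _ => 0 : ι → E n) : Star φ (E n)), ?_, ?_⟩
    · have h : Germ.map (fun x : E n => ‖x‖) ((fun _ => 0 : ι → E n) : Star φ (E n)) = 0 :=
        Germ.coe_eq.2 (Eventually.of_forall fun i => norm_zero)
      exact h.trans_le hδ.le
    · exact Germ.coe_eq.2 (Eventually.of_forall fun i => abs_zero)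
  · rintro _ ⟨ξ, -, rfl⟩
    induction ξ using Germ.inductionOn with | _ x => ?_
    exact Germ.coe_le.2 (Eventually.of_forall fun i => abs_zero.le)

/-- A discontinuous germ has a whole neighbourhood without continuous germs. -/
theorem exists_modulus_separating {δ : Star φ ℝ} (hδ : IsPosInfinitesimal δ) {g : germRing n}
    (hg : ¬ IsContinuousGerm g) :
    ∃ r ∈ moduli n δ, ∀ f : germRing n, IsContinuousGerm f → f - g ∉ nbhd n δ r := by
  obtain ⟨g, hg0⟩ := g
  induction g using Germ.inductionOn with | _ g => ?_
  induction δ using Germ.inductionOn with | _ d => ?_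
  have hd : ∀ᶠ i in (φ : Filter ι), 0 < d i := Germ.coe_lt.1 hδ.1
  have hpos : ∀ t, 0 < t → 0 < maxJump g t := fun t ht =>
    maxJump_pos fun h => hg ⟨g, rfl, _, Metric.ball_mem_nhds 0 ht, h⟩
  -- For `n = 0` there are no spheres of positive radius, but then every germ is continuous.
  have : Nontrivial (E n) := by
    by_contra h
    rw [not_nontrivial_iff_subsingleton] at h
    exact hg ⟨g, rfl, _, univ_mem, (continuous_of_discreteTopology (f := g)).continuousOn⟩
  -- Closeness `c` bounds the jumps by `2 * c`, so a quarter leaves a contradictory factor `1 / 2`.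
  refine ⟨((fun i => maxJump g (d i) / 4 : ι → ℝ) : Star φ ℝ),
    ⟨Germ.coe_lt.2 (hd.mono fun i hi => div_pos (hpos _ hi) four_pos),
      fun x => maxJump g ‖x‖ / 4, by simp [maxJump_zero], ?_⟩, ?_⟩
  · exact hasStarNorm_radial hd (m := fun t => maxJump g t / 4)
      (fun s t hst => div_le_div_of_nonneg_right (maxJump_mono g hst) four_pos.le)
      (fun t => div_nonneg (maxJump_nonneg g t) four_pos.le)
  · rintro f ⟨f', hf', U, hU, hcont⟩ ⟨F, hF, s, hFs, hsr⟩
    have hFfg : F =ᶠ[𝓝 0] fun x => f' x - g x := by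
      refine Germ.coe_eq.1 (hF.trans ?_)
      change f.1 - (g : (𝓝 (0 : E n)).Germ ℝ) = _
      rw [← hf']
      rfl
    obtain ⟨ρ, hρ, hball⟩ := Metric.mem_nhds_iff.1 (inter_mem hU hFfg)
    have hdρ : ∀ᶠ i in (φ : Filter ι), d i < ρ := Germ.coe_lt.1 (hδ.2 ρ hρ)
    -- One index suffices: the contradiction is reached on the standard ball of radius `d i`.
    obtain ⟨i, hi0, hiρ, hi⟩ := (hd.and (hdρ.and (hFs.eventually_lt hsr))).exists
    have hsub := (Metric.ball_subset_ball hiρ.le).trans hball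
    have hle := maxJump_le_of_near (div_nonneg (maxJump_nonneg g (d i)) four_pos.le)
      (hcont.mono fun x hx => (hsub hx).1) fun x hx => by
        have hx' : F x = f' x - g x := (hsub hx).2
        rw [← hx']
        exact (hi x (by simpa using (Metric.mem_ball.1 hx).le)).le
    linarith [hpos _ hi0]

/-- The continuous germs form a subring. -/
def continuousGermRing (n : ℕ) : NonUnitalSubring (germRing n) where
  carrier := {f | IsContinuousGerm f}
  zero_mem' := ⟨0, rfl, _, univ_mem, continuousOn_const⟩
  add_mem' := by
    rintro f g ⟨F, hF, U, hU, hFc⟩ ⟨G, hG, V, hV, hGc⟩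
    refine ⟨F + G, ?_, U ∩ V, inter_mem hU hV,
      (hFc.mono Set.inter_subset_left).add (hGc.mono Set.inter_subset_right)⟩
    change (F : (𝓝 (0 : E n)).Germ ℝ) + G = f.1 + g.1
    rw [hF, hG]
  mul_mem' := by
    rintro f g ⟨F, hF, U, hU, hFc⟩ ⟨G, hG, V, hV, hGc⟩
    refine ⟨F * G, ?_, U ∩ V, inter_mem hU hV,
      (hFc.mono Set.inter_subset_left).mul (hGc.mono Set.inter_subset_right)⟩
    change (F : (𝓝 (0 : E n)).Germ ℝ) * G = f.1 * g.1
    rw [hF, hG]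
  neg_mem' := by
    rintro f ⟨F, hF, U, hU, hFc⟩
    refine ⟨-F, ?_, U, hU, hFc.neg⟩
    change -(F : (𝓝 (0 : E n)).Germ ℝ) = -f.1
    rw [hF]

/-- The separating translate of `U_r` by `g` is a generator of the topology and contains `g`, as `0
∈ U_r`; so the complement is open. -/
theorem isClosed_continuousGermRing {δ : Star φ ℝ} (hδ : IsPosInfinitesimal δ) :
    IsClosed[tau n δ] (continuousGermRing n : Set (germRing n)) := by
  let _ : TopologicalSpace (germRing n) := tau n δ
  refine isOpen_compl_iff.1 (isOpen_iff_forall_mem_open.2 fun g hg => ?_)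
  obtain ⟨r, hr, hsep⟩ := exists_modulus_separating hδ hg
  refine ⟨_, ?_, TopologicalSpace.isOpen_generateFrom_of_mem ⟨g, r, hr, rfl⟩,
    ⟨0, zero_mem_nbhd hδ.1 hr.1, zero_add g⟩⟩
  rintro _ ⟨u, hu, rfl⟩ hc
  refine hsep _ hc ?_
  rwa [add_sub_cancel_right]

end Nonstandard

end GermTopology

theorem mainTheorem9 (n : ℕ) {ι : Type u} (φ : Ultrafilter ι) (δ : GermTopology.Star φ ℝ)
    (hδ : GermTopology.IsPosInfinitesimal δ) :
    (∀ (D : Type v) [Preorder D] [IsDirectedOrder D] [Nonempty D]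
        (f : D → GermTopology.germRing n) (g : GermTopology.germRing n),
        (∀ d, GermTopology.IsContinuousGerm (f d)) →
        GermTopology.NetConverges δ f g → GermTopology.IsContinuousGerm g) ∧
    ∃ S : NonUnitalSubring (GermTopology.germRing n),
      (S : Set (GermTopology.germRing n)) = {f | GermTopology.IsContinuousGerm f} ∧
      IsClosed[GermTopology.tau n δ] (S : Set (GermTopology.germRing n)) := by
  refine ⟨fun D _ _ _ f g hf hfg => ?_, GermTopology.continuousGermRing n, rfl,
    GermTopology.isClosed_continuousGermRing hδ⟩
  by_contra hg
  obtain ⟨r, hr, hsep⟩ := GermTopology.exists_modulus_separating hδ hg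
  obtain ⟨d, hd⟩ := hfg r hr
  exact hsep _ (hf d) (hd d le_rfl)
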